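/- Let $G$ be a finite group and $R$ a finite-dimensional complex representation of $G$ on a space $V$, $d=\dim V$. Let $R_0=1,R_1,\dots,R_n$ be all irreducible complex representations of $G$ up to isomorphism ($R_0$ trivial), with characters $\chi_0,\dots,\chi_n$; let $g_p$, $p=0,1,\dots,n$, be representatives of the conjugacy classes $C_p$ of $G$. For a representation $Q$ let $M[Q]$ be the matrix whose entry $M[Q]^i_j$ (row $i$, column $j$, $0\le i,j\le n$) is the multiplicity of $R_j$ in $Q\otimes R_i$. Put $$M[R_S(q)]=\sum_{m\ge 0}M[S^mR]\,q^m,\qquad M[R_A(-q)]=\sum_{m\ge 0}M[\Lambda^mR]\,(-q)^m,$$ where $S^mR$ and $\Lambda^mR$ are the symmetric and exterior powers, and let the Euclidean Clebsch–Gordan matrix $\widetilde M[R](q)$ be $M[R_A(-q)]$ with the row and the column of index $0$ deleted. Let $\theta_1,\dots,\theta_d$ be any homogeneous system of parameters of the algebra of invariants $S(V)^G$, of degrees $n_1,\dots,n_d$, and for every $j$ let $\rho_{1j},\dots,\rho_{\mu_jj}$ be any homogeneous elements, of degrees $m_{1j},\dots,m_{\mu_jj}$, of the $S(V)^G$-module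 of covariants $R_j^G=\mathrm{Hom}_G(R_j,S(V))$ such that $R_j^G=\bigoplus_{k=1}^{\mu_j}\rho_{kj}\,\mathbb C[\theta_1,\dots,\theta_d]$ is free over $\mathbb C[\theta_1,\dots,\theta_d]$ with basis $(\rho_{kj})_k$. Put $$D(R)=\frac{\prod_{k=1}^d(1-q^{n_k})}{(1-q)^d},\qquad D[R]^0_j=\sum_{k=1}^{\mu_j}q^{m_{kj}},\qquad D[R]^i_j=\sum_{k=0}^nM[R_i]^k_j\,D[R]^0_k .$$ Then, over the ring $\mathbb C[[q]]$, the matrix $\widetilde M[R](q)$ and all denominators below are invertible, and for $1\le i,j\le n$ $$\begin{aligned} (\widetilde M[R](q)^{-1})^i_j &=\frac{1}{M[R_S(q)]^0_0}\begin{vmatrix}M[R_S(q)]^0_0&M[R_S(q)]^0_j\\ M[R_S(q)]^i_0&M[R_S(q)]^i_j\end{vmatrix}\\ &=\frac1{|G|}\;\frac{\displaystyle\sum_{0\le p<r\le n}\frac{|C_p||C_r|\,(\chi_i(g_p)-\chi_i(g_r))\,\overline{(\chi_j(g_p)-\chi_j(g_r))}}{\det(E-qR(g_p))\,\det(E-qR(g_r))}}{\displaystyle\sum_{p=0}^n\frac{|C_p|}{\det(E-qR(g_p))}}\\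 &=\frac{1}{(1-q)^dD(R)\,D[R]^0_0}\begin{vmatrix}D[R]^0_0&D[R]^0_j\\ D[R]^i_0&D[R]^i_j\end{vmatrix}. \end{aligned}$$ -/

import Mathlib

noncomputable section

open scoped PowerSeries TensorProduct

namespace ClebschGordan

/-! ### Exterior and symmetric powers of a representation -/

section Powers

variable {G V : Type*} [Group G] [AddCommGroup V] [Module ℂ V]

/-- The `m`-th exterior power of a representation. -/
def exteriorRep (ρ : Representation ℂ G V) (m : ℕ) : Representation ℂ G (⋀[ℂ]^m V) where
  toFun g := exteriorPower.map m (ρ g)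
  map_one' := by
    rw [map_one]
    exact exteriorPower.map_id
  map_mul' g h := by
    rw [map_mul]
    exact exteriorPower.map_comp (ρ h) (ρ g)

/-- The action of an endomorphism of `V` on the symmetric algebra `S(V)`, by algebra maps. -/
def symMap (f : V →ₗ[ℂ] V) : SymmetricAlgebra ℂ V →ₐ[ℂ] SymmetricAlgebra ℂ V :=
  SymmetricAlgebra.lift ((SymmetricAlgebra.ι ℂ V).comp f)

@[simp]
lemma symMap_ι (f : V →ₗ[ℂ] V) (v : V) :
    symMap f (SymmetricAlgebra.ι ℂ V v) = SymmetricAlgebra.ι ℂ V (f v) := by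
  simp [symMap]

lemma symMap_one : symMap (1 : V →ₗ[ℂ] V) = AlgHom.id ℂ (SymmetricAlgebra ℂ V) := by
  ext v
  simp

lemma symMap_mul (f h : V →ₗ[ℂ] V) : symMap (f * h) = (symMap f).comp (symMap h) := by
  ext v
  simp

/-- The representation of `G` on the symmetric algebra `S(V)` induced by `ρ`. -/
def symAlgRep (ρ : Representation ℂ G V) : Representation ℂ G (SymmetricAlgebra ℂ V) where
  toFun g := (symMap (ρ g)).toLinearMap
  map_one' := by
    rw [map_one, symMap_one]
    rfl
  map_mul' g h := by
    rw [map_mul, symMap_mul]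
    rfl

variable (V) in
/-- The `m`-th symmetric power `Sᵐ(V)`: the span in `S(V)` of all products of `m` vectors. -/
def symPow (m : ℕ) : Submodule ℂ (SymmetricAlgebra ℂ V) :=
  LinearMap.range (SymmetricAlgebra.ι ℂ V) ^ m

lemma symPow_le_comap (ρ : Representation ℂ G V) (m : ℕ) (g : G) :
    symPow V m ≤ (symPow V m).comap (symAlgRep ρ g) := by
  rw [← Submodule.map_le_iff_le_comap]
  change Submodule.map (symMap (ρ g)).toLinearMap (symPow V m) ≤ symPow V m
  rw [symPow, Submodule.map_pow]
  refine pow_le_pow_left' ?_ m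
  rw [Submodule.map_le_iff_le_comap]
  rintro _ ⟨v, rfl⟩
  exact ⟨ρ g v, by simp⟩

/-- The `m`-th symmetric power of a representation. -/
def symRep (ρ : Representation ℂ G V) (m : ℕ) : Representation ℂ G (symPow V m) :=
  (symAlgRep ρ).subrepresentation (symPow V m) (symPow_le_comap ρ m)

/-- The power series `det (E - q f)` (a polynomial in `q` with constant term `1`). -/
def detOneSub [FiniteDimensional ℂ V] (f : V →ₗ[ℂ] V) : ℂ⟦X⟧ :=
  ((LinearMap.toMatrix (Module.finBasis ℂ V) (Module.finBasis ℂ V) f).charpolyRev : Polynomial ℂ)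

end Powers

/-! ### Irreducible representations and Clebsch–Gordan matrices -/

section CG

variable {G : Type*} [Group G] {n : ℕ} {W : Fin (n + 1) → Type*}
  [∀ i, AddCommGroup (W i)] [∀ i, Module ℂ (W i)]

/-- `R_0, …, R_n` is a complete list, without repetitions, of the irreducible complex
representations of `G`, and `R_0` is the trivial one. -/
structure IsIrrepList (σ : ∀ i, Representation ℂ G (W i)) : Prop where
  irreducible : ∀ i, (σ i).IsIrreducible
  trivial_zero : (σ 0).IsTrivial
  pairwise_not_equiv : ∀ i j, Nonempty ((σ i).Equiv (σ j)) → i = j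
  complete : ∀ (k : ℕ) (τ : Representation ℂ G (Fin k → ℂ)), τ.IsIrreducible →
    ∃ i, Nonempty (τ.Equiv (σ i))

/-- The multiplicity of an irreducible complex representation `τ` in a representation `Q`. -/
def multiplicity {A B : Type*} [AddCommGroup A] [Module ℂ A] [AddCommGroup B] [Module ℂ B]
    (τ : Representation ℂ G A) (Q : Representation ℂ G B) : ℕ :=
  Module.finrank ℂ (Representation.IntertwiningMap τ Q)

/-- The Clebsch–Gordan matrix `M[Q]`: the entry in row `i` and column `j` is the multiplicity
of `R_j` in `Q ⊗ R_i`. -/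
def cgMatrix (σ : ∀ i, Representation ℂ G (W i)) {B : Type*} [AddCommGroup B] [Module ℂ B]
    (Q : Representation ℂ G B) : Matrix (Fin (n + 1)) (Fin (n + 1)) ℕ :=
  Matrix.of fun i j => multiplicity (σ j) (Q.tprod (σ i))

variable {V : Type*} [AddCommGroup V] [Module ℂ V]

/-- `M[R_S(q)] = ∑ₘ M[Sᵐ R] qᵐ`. -/
def cgSym (σ : ∀ i, Representation ℂ G (W i)) (ρ : Representation ℂ G V) :
    Matrix (Fin (n + 1)) (Fin (n + 1)) ℂ⟦X⟧ :=
  Matrix.of fun i j => PowerSeries.mk fun m => (cgMatrix σ (symRep ρ m) i j : ℂ)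

/-- `M[R_A(-q)] = ∑ₘ M[Λᵐ R] (-q)ᵐ`. -/
def cgExtNeg (σ : ∀ i, Representation ℂ G (W i)) (ρ : Representation ℂ G V) :
    Matrix (Fin (n + 1)) (Fin (n + 1)) ℂ⟦X⟧ :=
  Matrix.of fun i j =>
    PowerSeries.mk fun m => (-1) ^ m * (cgMatrix σ (exteriorRep ρ m) i j : ℂ)

/-- The Euclidean Clebsch–Gordan matrix: `M[R_A(-q)]` without the row and the column of the
trivial representation. Its row and column indices `1, …, n` are `Fin.succ i`, `i : Fin n`. -/
def euclideanCG (σ : ∀ i, Representation ℂ G (W i)) (ρ : Representation ℂ G V) :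
    Matrix (Fin n) (Fin n) ℂ⟦X⟧ :=
  (cgExtNeg σ ρ).submatrix Fin.succ Fin.succ

/-- The size of the conjugacy class of `x`, as a complex number. -/
def classCard (x : G) : ℂ := (Nat.card (ConjClasses.mk x).carrier : ℂ)

end CG

/-! ### Homogeneous systems of parameters and covariants -/

section Covariants

variable {G V : Type*} [Group G] [AddCommGroup V] [Module ℂ V]

/-- The algebra of invariants `S(V)^G`. -/
def invariantAlgebra (ρ : Representation ℂ G V) : Subalgebra ℂ (SymmetricAlgebra ℂ V) where
  carrier := {f | ∀ g, symMap (ρ g) f = f}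
  mul_mem' ha hb g := by rw [map_mul, ha g, hb g]
  add_mem' ha hb g := by rw [map_add, ha g, hb g]
  algebraMap_mem' c g := by rw [AlgHom.commutes]

/-- `θ_1, …, θ_d` is a homogeneous system of parameters of `S(V)^G`, with degrees `deg k`. -/
structure IsHSOP (ρ : Representation ℂ G V) {d : ℕ} (θ : Fin d → invariantAlgebra ρ)
    (deg : Fin d → ℕ) : Prop where
  deg_pos : ∀ k, 0 < deg k
  homogeneous : ∀ k, (θ k : SymmetricAlgebra ℂ V) ∈ symPow V (deg k)
  algebraicIndependent : AlgebraicIndependent ℂ θ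
  finite : Module.Finite (Algebra.adjoin ℂ (Set.range θ)) (invariantAlgebra ρ)

variable {n : ℕ} {W : Fin (n + 1) → Type*} [∀ i, AddCommGroup (W i)] [∀ i, Module ℂ (W i)]

/-- A choice of a homogeneous system of parameters `θ_1, …, θ_d` (`d = dim V`) of `S(V)^G` and,
for each `j`, of homogeneous elements `ρ_{1j}, …, ρ_{μ_j j}`, of degrees `m_{kj}`, of the module of
covariants `Hom_G(R_j, S(V))` such that this module is `⨁ₖ ρ_{kj} ℂ[θ_1, …, θ_d]`. -/
structure CMDecomposition (ρ : Representation ℂ G V) (σ : ∀ i, Representation ℂ G (W i)) where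
  θ : Fin (Module.finrank ℂ V) → invariantAlgebra ρ
  deg : Fin (Module.finrank ℂ V) → ℕ
  isHSOP : IsHSOP ρ θ deg
  μ : Fin (n + 1) → ℕ
  gen : ∀ j, Fin (μ j) → Representation.IntertwiningMap (σ j) (symAlgRep ρ)
  m : ∀ j, Fin (μ j) → ℕ
  homogeneous : ∀ j k a, gen j k a ∈ symPow V (m j k)
  decomposition : ∀ j (φ : Representation.IntertwiningMap (σ j) (symAlgRep ρ)),
    ∃! p : Fin (μ j) → MvPolynomial (Fin (Module.finrank ℂ V)) ℂ,
      ∀ a, φ a =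
        ∑ k, MvPolynomial.aeval (fun l => (θ l : SymmetricAlgebra ℂ V)) (p k) * gen j k a

namespace CMDecomposition

variable {ρ : Representation ℂ G V} {σ : ∀ i, Representation ℂ G (W i)}

/-- The polynomial `D(R) = ∏ₖ (1 - q^{n_k}) / (1 - q)^d`. -/
def DR (D : CMDecomposition ρ σ) : Polynomial ℂ :=
  ∏ k, ∑ e ∈ Finset.range (D.deg k), Polynomial.X ^ e

lemma one_sub_pow_mul_DR (D : CMDecomposition ρ σ) :
    (1 - Polynomial.X) ^ Module.finrank ℂ V * D.DR = ∏ k, (1 - Polynomial.X ^ D.deg k) := by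
  have h : ((1 : Polynomial ℂ) - Polynomial.X) ^ Module.finrank ℂ V =
      ∏ _k : Fin (Module.finrank ℂ V), (1 - Polynomial.X) := by simp
  rw [h, DR, ← Finset.prod_mul_distrib]
  exact Finset.prod_congr rfl fun k _ => mul_neg_geom_sum _ _

/-- The polynomial `D[R]_j^0 = ∑ₖ q^{m_{kj}}`. -/
def Dzero (D : CMDecomposition ρ σ) (j : Fin (n + 1)) : Polynomial ℂ :=
  ∑ k, Polynomial.X ^ D.m j k

/-- The polynomial `D[R]_j^i = ∑ₖ M[R_i]_j^k D[R]_k^0`. -/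
def Dmat (D : CMDecomposition ρ σ) (i j : Fin (n + 1)) : Polynomial ℂ :=
  ∑ k, (cgMatrix σ (σ i) k j : Polynomial ℂ) * D.Dzero k

end CMDecomposition

end Covariants

end ClebschGordan

end

open scoped PowerSeries
open ClebschGordan

/-!
Write `A = M[R_S(q)]` and `B = M[R_A(-q)]`. The assignment `Q ↦ M[Q]` turns tensor products into
matrix products, so `A` and `B` are inverse to each other by the Koszul identity: for every group
element `g`, which acts diagonalisably because it has finite order,
`∑ₘ χ_{Sᵐ R}(g) qᵐ = 1 / det (E - q R(g))` (`inv_detOneSub`) and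
`∑ₘ χ_{Λᵐ R}(g) (-q)ᵐ = det (E - q R(g))` (`detOneSub_eq_mk`). The passage from characters to
matrices uses the orthogonality of irreducible characters and the fact that every character is the
combination of the `χ_k` given by its multiplicities
(`IsIrrepList.sum_multiplicity_mul_character`); the result is `IsIrrepList.cgSym_mul_cgExtNeg`.

Deleting a row and a column of `B = A⁻¹` and inverting gives the Schur complement
`A_{ij} - A_{i0} A_{0j} / A_{00}` (`schurComplement_mul_submatrix`). This is the first formula, and
the other two come from two further expressions for the entries of `A`.

* As sums over conjugacy classes (`cgSym_eq_sum_classes`, a form of Molien's theorem), the entries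
  are weighted sums with weights `|C_p| / det (E - q R(g_p))`, and the Binet–Cauchy identity
  (`weighted_sum_mul_sub`) rewrites the determinant as a sum over pairs of classes.
* The entry `A_{0j}` is the Hilbert series of the covariants `Hom_G(R_j, S(V))`. If these are free
  over `ℂ[θ_1, …, θ_d]`, the monomials in the `θ_k` times the generators are a homogeneous basis
  over `ℂ`, and counting it gives `A_{0j} = D[R]_j^0 / ((1 - q)^d D(R))`
  (`CMDecomposition.mk_multiplicity_mul`). The identity `A_{ij} = ∑ₖ M[R_i]_j^k A_{0k}` then
  yields `A_{ij} = D[R]_j^i / ((1 - q)^d D(R))` for all `i` and `j` (`CMDecomposition.cgSym_mul`).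
-/

open scoped TensorProduct

namespace ClebschGordan

open Module

/-! ### Diagonalisable operators -/

section Diagonal

variable {V : Type*} [AddCommGroup V] [Module ℂ V]

lemma exists_eigenbasis_of_pow_eq_one [FiniteDimensional ℂ V] (f : V →ₗ[ℂ] V) {N : ℕ}
    (hN : N ≠ 0) (hf : f ^ N = 1) :
    ∃ (b : Basis (Fin (finrank ℂ V)) ℂ V) (c : Fin (finrank ℂ V) → ℂ),
      (∀ i, f (b i) = c i • b i) ∧ ∀ i, c i ^ N = 1 := by
  -- `f` is a root of the separable polynomial `X ^ N - 1`
  have hss : Module.End.IsSemisimple (R := ℂ) f := by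
    refine Module.End.isSemisimple_of_squarefree_aeval_eq_zero (K := ℂ)
      (p := Polynomial.X ^ N - Polynomial.C 1) ?_ (by simp [hf])
    exact (Polynomial.separable_X_pow_sub_C (1 : ℂ) (by exact_mod_cast hN)
      one_ne_zero).squarefree
  let s : Set V := {v | ∃ c : ℂ, f v = c • v}
  have hs : ⊤ ≤ Submodule.span ℂ s := by
    rw [← hss.iSup_eigenspace_eq_top]
    refine iSup_le fun c v hv => Submodule.subset_span ⟨c, Module.End.mem_eigenspace_iff.mp hv⟩
  let b₀ := Basis.ofSpan hs
  have : Fintype ↑((linearIndepOn_empty ℂ id).extend (Set.empty_subset s)) :=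
    FiniteDimensional.fintypeBasisIndex b₀
  let b := b₀.reindex (Fintype.equivFinOfCardEq (finrank_eq_card_basis b₀).symm)
  have hb : ∀ i, ∃ c : ℂ, f (b i) = c • b i := fun i => by
    refine Basis.ofSpan_subset hs ⟨(Fintype.equivFinOfCardEq
      (finrank_eq_card_basis b₀).symm).symm i, ?_⟩
    simp [b, b₀]
  choose c hc using hb
  refine ⟨b, c, hc, fun i => ?_⟩
  have hpow : ∀ k : ℕ, (f ^ k) (b i) = c i ^ k • b i := fun k => by
    induction k with
    | zero => simp
    | succ k ih => rw [pow_succ', Module.End.mul_apply, ih, map_smul, hc, smul_smul, pow_succ]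
  have h := hpow N
  rw [hf, Module.End.one_apply] at h
  exact (smul_left_injective ℂ (b.ne_zero i) (by simpa using h)).symm

lemma trace_of_eigenbasis {ι : Type*} [Fintype ι] (b : Basis ι ℂ V) (f : V →ₗ[ℂ] V) (c : ι → ℂ)
    (h : ∀ i, f (b i) = c i • b i) : LinearMap.trace ℂ V f = ∑ i, c i := by
  classical
  rw [LinearMap.trace_eq_matrix_trace ℂ b]
  simp [Matrix.trace, LinearMap.toMatrix_apply, h]

lemma detOneSub_of_eigenbasis [FiniteDimensional ℂ V] {ι : Type*} [Fintype ι] (b : Basis ι ℂ V)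
    (f : V →ₗ[ℂ] V) (c : ι → ℂ) (h : ∀ i, f (b i) = c i • b i) :
    detOneSub f = ∏ i, (1 - PowerSeries.C (c i) * PowerSeries.X) := by
  classical
  have hd : LinearMap.toMatrix b b f = Matrix.diagonal c := by
    ext i j
    rcases eq_or_ne i j with rfl | hij
    · simp [LinearMap.toMatrix_apply, h]
    · simp [LinearMap.toMatrix_apply, h, hij]
  have hp : (1 - (Polynomial.X : Polynomial ℂ) • (Matrix.diagonal c).map Polynomial.C) =
      Matrix.diagonal fun i => 1 - Polynomial.C (c i) * Polynomial.X := by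
    rw [Matrix.diagonal_map (map_zero _), ← Matrix.diagonal_one, ← Matrix.diagonal_smul,
      Matrix.diagonal_sub]
    congr 1
    ext1 i
    simp [Polynomial.X_mul_C]
  rw [detOneSub, ← Matrix.reverse_charpoly, LinearMap.charpoly_toMatrix,
    ← LinearMap.charpoly_toMatrix f b, Matrix.reverse_charpoly, hd, Matrix.charpolyRev, hp,
    Matrix.det_diagonal, ← Polynomial.coeToPowerSeries.ringHom_apply, map_prod]
  simp

end Diagonal

/-! ### Exterior powers of a diagonalisable operator -/

section Exterior

lemma exteriorPower_map_of_eigenbasis {V ι : Type*} [AddCommGroup V] [Module ℂ V]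
    [LinearOrder ι] (b : Basis ι ℂ V) (f : V →ₗ[ℂ] V) (c : ι → ℂ)
    (h : ∀ i, f (b i) = c i • b i) (m : ℕ) (s : Set.powersetCard ι m) :
    exteriorPower.map m f (b.exteriorPower m s) =
      (∏ i ∈ (s : Finset ι), c i) • b.exteriorPower m s := by
  have hf : f ∘ b ∘ Set.powersetCard.ofFinEmbEquiv.symm s =
      fun j => c (Set.powersetCard.ofFinEmbEquiv.symm s j) •
        (b ∘ Set.powersetCard.ofFinEmbEquiv.symm s) j := by
    ext1 j
    exact h _
  rw [exteriorPower.basis_apply, exteriorPower.ιMulti_family, exteriorPower.map_apply_ιMulti, hf,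
    AlternatingMap.map_smul_univ]
  congr 1
  have hs : Finset.univ.map (Finset.orderEmbOfFin (s : Finset ι) s.2).toEmbedding = s :=
    Finset.map_orderEmbOfFin_univ _ _
  conv_rhs => rw [← hs]
  rw [Finset.prod_map]
  simp [Set.powersetCard.ofFinEmbEquiv_symm_apply]

lemma mk_trace_exteriorPower {V ι : Type*} [AddCommGroup V] [Module ℂ V] [Fintype ι]
    [LinearOrder ι] (b : Basis ι ℂ V) (f : V →ₗ[ℂ] V) (c : ι → ℂ)
    (h : ∀ i, f (b i) = c i • b i) :
    (PowerSeries.mk fun m => (-1) ^ m * LinearMap.trace ℂ _ (exteriorPower.map m f)) =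
      ∏ i, (1 - PowerSeries.C (c i) * PowerSeries.X) := by
  classical
  ext m
  have hfac : ∀ t : Finset ι, ∏ i ∈ t, -(PowerSeries.C (c i) * PowerSeries.X) =
      PowerSeries.C ((-1) ^ t.card * ∏ i ∈ t, c i) * PowerSeries.X ^ t.card := fun t => by
    simp_rw [← neg_mul]
    rw [Finset.prod_mul_distrib, Finset.prod_neg]
    simp
  have : Fintype (Set.powersetCard ι m) := Fintype.ofFinite _
  simp_rw [sub_eq_add_neg]
  rw [Finset.prod_one_add, Finset.powerset_univ, map_sum, PowerSeries.coeff_mk,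
    trace_of_eigenbasis (b.exteriorPower m) _ _ (exteriorPower_map_of_eigenbasis b f c h m)]
  simp_rw [hfac, PowerSeries.coeff_C_mul, PowerSeries.coeff_X_pow, mul_ite, mul_one, mul_zero]
  rw [← Finset.sum_filter, Finset.mul_sum]
  refine Finset.sum_bij (fun s _ => (s : Finset ι)) (fun s _ => ?_) (fun s _ t _ hst => ?_)
    (fun t ht => ?_) (fun s _ => ?_)
  · simp
  · exact Subtype.ext hst
  · exact ⟨⟨t, by simpa using (Finset.mem_filter.mp ht).2.symm⟩, Finset.mem_univ _, rfl⟩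
  · rw [show (s : Finset ι).card = m from s.2]

end Exterior

/-! ### Hilbert series -/

section Graded

variable {H ι : Type*} [AddCommGroup H] [Module ℂ H] {b : ι → H} {A : ℕ → Submodule ℂ H}
  {δ : ι → ℕ}

/-- If homogeneous vectors span, then those of degree `m` span the component of degree `m`. -/
lemma eq_span_of_iSupIndep (hA : iSupIndep A) (hspan : ⊤ ≤ Submodule.span ℂ (Set.range b))
    (hb : ∀ i, b i ∈ A (δ i)) (m : ℕ) :
    A m = Submodule.span ℂ (Set.range fun i : {i // δ i = m} => b i) := by
  classical
  refine le_antisymm (fun x hx => ?_) ?_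
  · obtain ⟨l, rfl⟩ :=
      Finsupp.mem_span_range_iff_exists_finsupp.mp (hspan (Submodule.mem_top (x := x)))
    rw [Finsupp.sum, ← Finset.sum_filter_add_sum_filter_not _ (fun i => δ i = m)] at hx ⊢
    set x₁ := ∑ i ∈ l.support with δ i = m, l i • b i
    set x₂ := ∑ i ∈ l.support with ¬ δ i = m, l i • b i
    have h₁ : x₁ ∈ Submodule.span ℂ (Set.range fun i : {i // δ i = m} => b i) :=
      Submodule.sum_mem _ fun i hi => Submodule.smul_mem _ _
        (Submodule.subset_span ⟨⟨i, (Finset.mem_filter.mp hi).2⟩, rfl⟩)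
    have h₁' : x₁ ∈ A m := Submodule.sum_mem _ fun i hi => Submodule.smul_mem _ _
      ((Finset.mem_filter.mp hi).2 ▸ hb i)
    have h₂ : x₂ ∈ ⨆ j, ⨆ _ : j ≠ m, A j := Submodule.sum_mem _ fun i hi =>
      Submodule.smul_mem _ _ (Submodule.mem_iSup_of_mem (δ i)
        (Submodule.mem_iSup_of_mem (Finset.mem_filter.mp hi).2 (hb i)))
    have h₂' : x₂ ∈ A m := (Submodule.add_mem_iff_right _ h₁').mp hx
    rwa [Submodule.disjoint_def.mp (hA m) x₂ h₂' h₂, add_zero]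
  · rw [Submodule.span_le]
    rintro _ ⟨⟨i, rfl⟩, rfl⟩
    exact hb i

/-- The basis of a graded component given by the elements of that degree in a homogeneous
basis. -/
noncomputable def componentBasis (b : Basis ι ℂ H) (hA : iSupIndep A) (hb : ∀ i, b i ∈ A (δ i))
    (m : ℕ) : Basis {i // δ i = m} ℂ (A m) :=
  (Basis.span (b.linearIndependent.comp (Subtype.val : {i // δ i = m} → ι)
    Subtype.val_injective)).map
    (LinearEquiv.ofEq _ _ (eq_span_of_iSupIndep hA b.span_eq.ge hb m).symm)

lemma coe_componentBasis (b : Basis ι ℂ H) (hA : iSupIndep A) (hb : ∀ i, b i ∈ A (δ i))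
    (m : ℕ) (i : {i // δ i = m}) : (componentBasis b hA hb m i : H) = b i := by
  simp [componentBasis, Basis.span_apply]

end Graded

section Weight

variable {ι : Type*} [Fintype ι]

lemma finite_weight_eq {w : ι → ℕ} (hw : ∀ i, 0 < w i) (m : ℕ) :
    Finite {e : ι →₀ ℕ // Finsupp.weight w e = m} :=
  ((Finsupp.finite_of_nat_weight_le w (fun i => (hw i).ne') m).subset fun _ he => le_of_eq he :
    {e : ι →₀ ℕ | Finsupp.weight w e = m}.Finite)

/-- The expansion of `∏ᵢ (1 - cᵢ q^{wᵢ})⁻¹` as a sum over monomials: Molien's computation. -/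
lemma mk_sum_weight_mul_prod {w : ι → ℕ} (hw : ∀ i, 0 < w i) (c : ι → ℂ)
    [∀ m, Fintype {e : ι →₀ ℕ // Finsupp.weight w e = m}] :
    (PowerSeries.mk fun m => ∑ e : {e : ι →₀ ℕ // Finsupp.weight w e = m},
        ∏ i, c i ^ (e : ι →₀ ℕ) i) *
      ∏ i, (1 - PowerSeries.C (c i) * PowerSeries.X ^ w i) = 1 := by
  classical
  -- the geometric series `F i = (1 - cᵢ q^{wᵢ})⁻¹`
  let F : ι → ℂ⟦X⟧ := fun i => PowerSeries.mk fun a => if w i ∣ a then c i ^ (a / w i) else 0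
  have hF : ∀ i, F i * (1 - PowerSeries.C (c i) * PowerSeries.X ^ w i) = 1 := fun i => by
    ext a
    rw [mul_sub, mul_one, mul_left_comm, map_sub, PowerSeries.coeff_C_mul,
      PowerSeries.coeff_mul_X_pow', PowerSeries.coeff_one]
    simp only [F, PowerSeries.coeff_mk]
    rcases Nat.lt_or_ge a (w i) with ha | ha
    · rcases Nat.eq_zero_or_pos a with rfl | ha'
      · simp [(hw i).ne']
      · simp [Nat.not_dvd_of_pos_of_lt ha' ha, ha'.ne', not_le.mpr ha]
    · obtain ⟨a, rfl⟩ := Nat.exists_eq_add_of_le ha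
      have : (w i + a) / w i = a / w i + 1 := by
        rw [Nat.add_div_left _ (hw i)]
      simp [this, pow_succ', (hw i).ne']
  have hprod : (PowerSeries.mk fun m => ∑ e : {e : ι →₀ ℕ // Finsupp.weight w e = m},
      ∏ i, c i ^ (e : ι →₀ ℕ) i) = ∏ i, F i := by
    ext m
    rw [PowerSeries.coeff_mk, PowerSeries.coeff_prod]
    -- the monomial `e` contributes to the exponents `(eᵢ wᵢ)ᵢ`; other exponents contribute zero
    refine Finset.sum_of_injOn (fun e => Finsupp.equivFunOnFinite.symm fun i =>
        (e : ι →₀ ℕ) i * w i) (fun e _ e' _ h => ?_) (fun e _ => ?_) (fun s hs hns => ?_)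
      (fun e _ => ?_)
    · refine Subtype.ext (Finsupp.ext fun i => ?_)
      have := DFunLike.congr_fun h i
      exact Nat.eq_of_mul_eq_mul_right (hw i) (by simpa using this)
    · have := e.2
      rw [Finsupp.weight_apply, Finsupp.sum_fintype _ _ (by simp)] at this
      simpa [Finset.mem_finsuppAntidiag] using this
    · by_contra hne
      have hdvd : ∀ i, w i ∣ s i := fun i => by
        by_contra hi
        exact hne (Finset.prod_eq_zero (Finset.mem_univ i) (by simp [F, hi]))
      refine hns ⟨⟨Finsupp.equivFunOnFinite.symm fun i => s i / w i, ?_⟩, by simp, ?_⟩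
      · rw [Finsupp.weight_apply, Finsupp.sum_fintype _ _ (by simp)]
        simpa [Finset.mem_finsuppAntidiag, Nat.div_mul_cancel (hdvd _)] using hs
      · ext i
        simp [Nat.div_mul_cancel (hdvd _)]
    · refine Finset.prod_congr rfl fun i _ => ?_
      simp [F, hw i]
  rw [hprod, ← Finset.prod_mul_distrib]
  exact Finset.prod_eq_one fun i _ => hF i

end Weight

/-! ### Symmetric powers of a diagonalisable operator -/

section Symmetric

variable {V ι : Type*} [AddCommGroup V] [Module ℂ V]

lemma symPow_eq_map (b : Basis ι ℂ V) (m : ℕ) :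
    symPow V m = (MvPolynomial.homogeneousSubmodule ι ℂ m).map
      (SymmetricAlgebra.equivMvPolynomial b).symm.toLinearMap := by
  have h : LinearMap.range (SymmetricAlgebra.ι ℂ V) =
      (MvPolynomial.homogeneousSubmodule ι ℂ 1).map
        (SymmetricAlgebra.equivMvPolynomial b).symm.toAlgHom.toLinearMap := by
    rw [MvPolynomial.homogeneousSubmodule_one_eq_span_X, Submodule.map_span, ← Set.range_comp,
      LinearMap.range_eq_map, ← b.span_eq, Submodule.map_span, ← Set.range_comp]
    congr 2
    ext1 i
    simp
  rw [symPow, h, ← Submodule.map_pow, MvPolynomial.homogeneousSubmodule_one_pow]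
  rfl

variable (V) in
lemma iSupIndep_symPow : iSupIndep (symPow V) := by
  let b := Basis.ofVectorSpace ℂ V
  let _ := MvPolynomial.gradedAlgebra (σ := Basis.ofVectorSpaceIndex ℂ V) (R := ℂ)
  have h := (DirectSum.Decomposition.isInternal
    (MvPolynomial.homogeneousSubmodule (Basis.ofVectorSpaceIndex ℂ V) ℂ)).submodule_iSupIndep
  have h' := (iSupIndep_map_orderIso_iff (Submodule.orderIsoMapComap
    (SymmetricAlgebra.equivMvPolynomial b).symm.toLinearEquiv)).mpr h
  convert h' using 1
  ext1 m
  exact symPow_eq_map b m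

variable [Fintype ι]

lemma basis_symmetricAlgebra_apply (b : Basis ι ℂ V) (e : ι →₀ ℕ) :
    b.symmetricAlgebra e = ∏ i, SymmetricAlgebra.ι ℂ V (b i) ^ e i := by
  simp [Basis.symmetricAlgebra, MvPolynomial.monomial_eq, Finsupp.prod_fintype]

omit [Fintype ι] in
lemma basis_symmetricAlgebra_mem (b : Basis ι ℂ V) (e : ι →₀ ℕ) :
    b.symmetricAlgebra e ∈ symPow V (Finsupp.weight (1 : ι → ℕ) e) := by
  rw [symPow_eq_map b]
  refine ⟨MvPolynomial.monomial e 1, ?_, by simp [Basis.symmetricAlgebra]⟩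
  exact MvPolynomial.isWeightedHomogeneous_monomial _ _ _ rfl

/-- `∑ₘ tr(Sᵐ f) qᵐ = 1 / det (E - q f)` for a diagonalisable operator `f`. -/
lemma mk_trace_symPow_mul (b : Basis ι ℂ V) (f : V →ₗ[ℂ] V) (c : ι → ℂ)
    (h : ∀ i, f (b i) = c i • b i) (S : ∀ m, symPow V m →ₗ[ℂ] symPow V m)
    (hS : ∀ m x, (S m x : SymmetricAlgebra ℂ V) = symMap f x) :
    (PowerSeries.mk fun m => LinearMap.trace ℂ _ (S m)) *
      ∏ i, (1 - PowerSeries.C (c i) * PowerSeries.X) = 1 := by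
  have hfin := finite_weight_eq (w := (1 : ι → ℕ)) (fun _ => one_pos)
  let _ := fun m => @Fintype.ofFinite _ (hfin m)
  have hw := mk_sum_weight_mul_prod (w := (1 : ι → ℕ)) (fun _ => one_pos) c
  simp only [Pi.one_apply, pow_one] at hw
  refine Eq.trans (congrArg (fun s : ℂ⟦X⟧ => s * _)
    (congrArg PowerSeries.mk (funext fun m => ?_))) hw
  refine trace_of_eigenbasis
    (componentBasis b.symmetricAlgebra (iSupIndep_symPow V) (basis_symmetricAlgebra_mem b) m)
    _ _ fun e => Subtype.ext ?_
  rw [hS, Submodule.coe_smul, coe_componentBasis, basis_symmetricAlgebra_apply, map_prod]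
  simp [h, smul_pow, Finset.prod_smul]

end Symmetric

/-! ### Characters and multiplicities -/

section Characters

variable {G : Type*} [Group G] [Fintype G]

lemma exists_eigenbasis {V : Type*} [AddCommGroup V] [Module ℂ V] [FiniteDimensional ℂ V]
    (ρ : Representation ℂ G V) (g : G) :
    ∃ (b : Basis (Fin (finrank ℂ V)) ℂ V) (c : Fin (finrank ℂ V) → ℂ),
      (∀ i, ρ g (b i) = c i • b i) ∧ ∀ i, ‖c i‖ = 1 := by
  obtain ⟨b, c, hb, hc⟩ := exists_eigenbasis_of_pow_eq_one (ρ g) (orderOf_pos g).ne'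
    (by rw [← map_pow, pow_orderOf_eq_one, map_one])
  exact ⟨b, c, hb, fun i => Complex.norm_eq_one_of_pow_eq_one (hc i) (orderOf_pos g).ne'⟩

/-- The eigenvalues of `ρ g` are roots of unity, hence inverted by complex conjugation. -/
lemma character_inv {V : Type*} [AddCommGroup V] [Module ℂ V] [FiniteDimensional ℂ V]
    (ρ : Representation ℂ G V) (g : G) :
    ρ.character g⁻¹ = (starRingEnd ℂ) (ρ.character g) := by
  obtain ⟨b, c, hb, hc⟩ := exists_eigenbasis ρ g
  have hc0 : ∀ i, c i ≠ 0 := fun i h0 => by simpa [h0] using hc i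
  have hb' : ∀ i, ρ g⁻¹ (b i) = (starRingEnd ℂ) (c i) • b i := fun i => by
    rw [← Complex.inv_eq_conj (hc i), eq_inv_smul_iff₀ (hc0 i), ← map_smul, ← hb,
      Representation.inv_self_apply]
  rw [Representation.character, Representation.character, trace_of_eigenbasis b _ _ hb,
    trace_of_eigenbasis b _ _ hb', map_sum]

lemma natCast_multiplicity {A B : Type*} [AddCommGroup A] [Module ℂ A] [FiniteDimensional ℂ A]
    [AddCommGroup B] [Module ℂ B] [FiniteDimensional ℂ B]
    (τ : Representation ℂ G A) (Q : Representation ℂ G B) :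
    (multiplicity τ Q : ℂ) =
      (Nat.card G : ℂ)⁻¹ * ∑ g, Q.character g * τ.character g⁻¹ := by
  have : Invertible (Nat.card G : ℂ) :=
    invertibleOfNonzero (by exact_mod_cast Nat.card_pos.ne')
  exact (Representation.card_inv_mul_sum_char_mul_char_eq_finrank τ Q).symm

omit [Fintype G] in
lemma character_add_of_isCompl {B : Type*} [AddCommGroup B] [Module ℂ B] [FiniteDimensional ℂ B]
    {Q : Representation ℂ G B} {S T : Subrepresentation Q} (h : IsCompl S T) (g : G) :
    Q.character g = S.toRepresentation.character g + T.toRepresentation.character g := by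
  have hc : IsCompl S.toSubmodule T.toSubmodule := by
    refine ⟨disjoint_iff.mpr ?_, codisjoint_iff.mpr ?_⟩
    · rw [← Subrepresentation.toSubmodule_inf, h.inf_eq_bot]
      rfl
    · rw [← Subrepresentation.toSubmodule_sup, h.sup_eq_top]
      rfl
  have hconj : Q g = (Submodule.prodEquivOfIsCompl _ _ hc).conj
      ((S.toRepresentation g).prodMap (T.toRepresentation g)) := by
    refine LinearMap.ext fun x => ?_
    obtain ⟨y, rfl⟩ := (Submodule.prodEquivOfIsCompl _ _ hc).surjective x
    rw [LinearEquiv.conj_apply_apply, LinearEquiv.symm_apply_apply]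
    simp [Subrepresentation.toRepresentation]
  rw [Representation.character, hconj, LinearMap.trace_conj', LinearMap.trace_prodMap']
  rfl

variable {n : ℕ} {W : Fin (n + 1) → Type*} [∀ i, AddCommGroup (W i)] [∀ i, Module ℂ (W i)]
  [∀ i, FiniteDimensional ℂ (W i)] {σ : ∀ i, Representation ℂ G (W i)}

lemma IsIrrepList.inner_character (hσ : IsIrrepList σ) (i j : Fin (n + 1)) :
    (Nat.card G : ℂ)⁻¹ * ∑ g, (σ i).character g * (σ j).character g⁻¹ =
      if i = j then 1 else 0 := by
  classical
  have : Invertible (Nat.card G : ℂ) :=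
    invertibleOfNonzero (by exact_mod_cast Nat.card_pos.ne')
  have := hσ.irreducible i
  have := hσ.irreducible j
  rw [Representation.char_orthonormal]
  refine if_congr ⟨fun h => (hσ.pairwise_not_equiv _ _ h).symm, ?_⟩ rfl rfl
  rintro rfl
  exact ⟨Representation.Equiv.refl _⟩

/-- A trivial irreducible representation is one-dimensional, because its character, the constant
function `dim R₀`, has norm one. -/
lemma IsIrrepList.character_zero (hσ : IsIrrepList σ) (g : G) : (σ 0).character g = 1 := by
  have := hσ.trivial_zero
  have hd : ∀ g, (σ 0).character g = (finrank ℂ (W 0) : ℂ) := fun g => by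
    rw [Representation.character, Representation.isTrivial_def, LinearMap.trace_id]
  have h := hσ.inner_character 0 0
  have hcard : (Nat.card G : ℂ) ≠ 0 := by exact_mod_cast Nat.card_pos.ne'
  simp only [hd, Finset.sum_const, Finset.card_univ, ← Nat.card_eq_fintype_card, nsmul_eq_mul,
    inv_mul_cancel_left₀ hcard, if_true] at h
  have h' : finrank ℂ (W 0) * finrank ℂ (W 0) = 1 := by exact_mod_cast h
  rw [hd, Nat.eq_one_of_mul_eq_one_right h', Nat.cast_one]

omit [Fintype G] in
lemma isIrreducible_of_equiv {A B : Type*} [AddCommGroup A] [Module ℂ A] [AddCommGroup B]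
    [Module ℂ B] {τ : Representation ℂ G A} {Q : Representation ℂ G B} (e : Q.Equiv τ)
    (hQ : Q.IsIrreducible) : τ.IsIrreducible := by
  let f : Subrepresentation τ → Subrepresentation Q := fun U =>
    ⟨U.toSubmodule.comap e.toLinearEquiv.toLinearMap, fun g v hv => by
      have h : e (Q g v) = τ g (e v) := e.toIntertwiningMap.isIntertwining _ _ g v
      have h' := U.apply_mem_toSubmodule g hv
      simpa [h] using h'⟩
  have hf : Function.Injective f := fun U U' h => Subrepresentation.toSubmodule_injective
    (Submodule.comap_injective_of_surjective e.toLinearEquiv.surjective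
      (congrArg Subrepresentation.toSubmodule h))
  have hbot : f ⊥ = ⊥ := Subrepresentation.toSubmodule_injective
    (LinearMap.ker_eq_bot.mpr e.toLinearEquiv.injective)
  have htop : f ⊤ = ⊤ := Subrepresentation.toSubmodule_injective (Submodule.comap_top _)
  have hnt : (⊥ : Subrepresentation τ) ≠ ⊤ := fun h => by
    have := congrArg f h
    rw [hbot, htop] at this
    exact bot_ne_top this
  exact {
    exists_pair_ne := ⟨_, _, hnt⟩
    eq_bot_or_eq_top := fun U => (eq_bot_or_eq_top (f U)).imp
      (fun h => hf (h.trans hbot.symm)) (fun h => hf (h.trans htop.symm)) }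

omit [∀ i, FiniteDimensional ℂ (W i)] [Fintype G] in
/-- Completeness of the list is stated for representations on the spaces `Fin k → ℂ`; a choice of
basis extends it to all finite-dimensional spaces. -/
lemma IsIrrepList.exists_character_eq (hσ : IsIrrepList σ) {B : Type*} [AddCommGroup B]
    [Module ℂ B] [FiniteDimensional ℂ B] (Q : Representation ℂ G B) (hQ : Q.IsIrreducible) :
    ∃ i, Q.character = (σ i).character := by
  let e := (finBasis ℂ B).equivFun
  let τ : Representation ℂ G (Fin (finrank ℂ B) → ℂ) :=
    (e.conjAlgEquiv ℂ : End ℂ B →* End ℂ _).comp Q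
  let E : Q.Equiv τ := Representation.Equiv.mk e fun g => by
    ext x
    simp [τ]
  obtain ⟨i, ⟨F⟩⟩ := hσ.complete _ τ (isIrreducible_of_equiv E hQ)
  exact ⟨i, Representation.char_iso (E.trans F)⟩

/-- Complete reducibility, in terms of characters: `χ_Q = ∑ₖ (multiplicity of R_k in Q) χ_k`. -/
lemma IsIrrepList.sum_multiplicity_mul_character (hσ : IsIrrepList σ) {B : Type*}
    [AddCommGroup B] [Module ℂ B] [FiniteDimensional ℂ B] (Q : Representation ℂ G B) (g : G) :
    ∑ k, (multiplicity (σ k) Q : ℂ) * (σ k).character g = Q.character g := by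
  -- multiplicities are additive because they are inner products of characters, so a proper
  -- subrepresentation and its complement reduce the claim to smaller dimension
  induction hN : finrank ℂ B using Nat.strong_induction_on generalizing B with
  | _ N ih =>
  by_cases hQ : Q.IsIrreducible
  · obtain ⟨i, hi⟩ := hσ.exists_character_eq Q hQ
    simp_rw [natCast_multiplicity, hi, hσ.inner_character]
    simp
  · by_cases hB : Subsingleton B
    · have h0 : ∀ g, Q.character g = 0 := fun g => by
        rw [Representation.character, Subsingleton.elim (Q g) 0, map_zero]
      simp [natCast_multiplicity, h0]
    have : Nontrivial (Subrepresentation Q) := by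
      refine ⟨⊥, ⊤, fun h => hB ?_⟩
      have h' := congrArg Subrepresentation.toSubmodule h
      exact (Submodule.subsingleton_iff ℂ).mp (subsingleton_of_bot_eq_top h')
    obtain ⟨S, hS₀, hS₁⟩ : ∃ S : Subrepresentation Q, S ≠ ⊥ ∧ S ≠ ⊤ := by
      by_contra! h
      exact hQ ⟨fun S => or_iff_not_imp_left.mpr (h S)⟩
    obtain ⟨T, hST⟩ := exists_isCompl S
    have hT₁ : T ≠ ⊤ := by
      rintro rfl
      exact hS₀ (by simpa using hST.inf_eq_bot)
    have hlt : ∀ U : Subrepresentation Q, U ≠ ⊤ → finrank ℂ U.toSubmodule < N := fun U hU => by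
      rw [← hN]
      refine Submodule.finrank_lt fun h => hU (Subrepresentation.toSubmodule_injective ?_)
      exact h
    have hadd := character_add_of_isCompl hST
    rw [hadd, ← ih _ (hlt S hS₁) S.toRepresentation rfl, ← ih _ (hlt T hT₁) T.toRepresentation rfl,
      ← Finset.sum_add_distrib]
    refine Finset.sum_congr rfl fun k _ => ?_
    simp_rw [natCast_multiplicity, hadd, add_mul, Finset.sum_add_distrib]
    ring

end Characters

/-! ### Clebsch–Gordan matrices as class sums -/

section ClassSums

variable {G : Type*} [Group G] [Fintype G] {V : Type*} [AddCommGroup V] [Module ℂ V]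
  [FiniteDimensional ℂ V]

instance finiteDimensional_symPow (m : ℕ) : FiniteDimensional ℂ (symPow V m) :=
  Module.Finite.iff_fg.mpr
    ((Module.Finite.iff_fg.mp (Module.Finite.range (SymmetricAlgebra.ι ℂ V))).pow m)

lemma constantCoeff_detOneSub (ρ : Representation ℂ G V) (g : G) :
    PowerSeries.constantCoeff (detOneSub (ρ g)) = 1 := by
  obtain ⟨b, c, hb, -⟩ := exists_eigenbasis ρ g
  simp [detOneSub_of_eigenbasis b _ c hb, map_prod]

lemma constantCoeff_detOneSub_ne_zero (ρ : Representation ℂ G V) (g : G) :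
    PowerSeries.constantCoeff (detOneSub (ρ g)) ≠ 0 := by
  simp [constantCoeff_detOneSub]

/-- The generating function of the characters of the symmetric powers. -/
lemma inv_detOneSub (ρ : Representation ℂ G V) (g : G) :
    (detOneSub (ρ g))⁻¹ = PowerSeries.mk fun m => (symRep ρ m).character g := by
  obtain ⟨b, c, hb, -⟩ := exists_eigenbasis ρ g
  refine ((PowerSeries.eq_inv_iff_mul_eq_one (constantCoeff_detOneSub_ne_zero ρ g)).mpr ?_).symm
  rw [detOneSub_of_eigenbasis b _ c hb]
  exact mk_trace_symPow_mul b (ρ g) c hb (fun m => symRep ρ m g) fun m x => rfl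

/-- The generating function of the characters of the exterior powers. -/
lemma detOneSub_eq_mk (ρ : Representation ℂ G V) (g : G) :
    detOneSub (ρ g) = PowerSeries.mk fun m => (-1) ^ m * (exteriorRep ρ m).character g := by
  obtain ⟨b, c, hb, -⟩ := exists_eigenbasis ρ g
  rw [detOneSub_of_eigenbasis b _ c hb, ← mk_trace_exteriorPower b _ c hb]
  rfl

variable {n : ℕ} {W : Fin (n + 1) → Type*} [∀ i, AddCommGroup (W i)] [∀ i, Module ℂ (W i)]
  [∀ i, FiniteDimensional ℂ (W i)] (σ : ∀ i, Representation ℂ G (W i))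

lemma natCast_cgMatrix {B : Type*} [AddCommGroup B] [Module ℂ B] [FiniteDimensional ℂ B]
    (Q : Representation ℂ G B) (i j : Fin (n + 1)) :
    (cgMatrix σ Q i j : ℂ) = (Nat.card G : ℂ)⁻¹ *
      ∑ g, (σ i).character g * (σ j).character g⁻¹ * Q.character g := by
  rw [cgMatrix, Matrix.of_apply, natCast_multiplicity, Representation.char_tensor]
  congr 1
  exact Finset.sum_congr rfl fun g _ => by rw [Pi.mul_apply]; ring

lemma cgSym_apply (ρ : Representation ℂ G V) (i j : Fin (n + 1)) :
    cgSym σ ρ i j = PowerSeries.C (Nat.card G : ℂ)⁻¹ *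
      ∑ g, PowerSeries.C ((σ i).character g * (σ j).character g⁻¹) * (detOneSub (ρ g))⁻¹ := by
  ext m
  simp_rw [inv_detOneSub]
  rw [PowerSeries.coeff_C_mul, map_sum]
  simp_rw [PowerSeries.coeff_C_mul, PowerSeries.coeff_mk]
  rw [cgSym, Matrix.of_apply, PowerSeries.coeff_mk, natCast_cgMatrix]

lemma cgExtNeg_apply (ρ : Representation ℂ G V) (i j : Fin (n + 1)) :
    cgExtNeg σ ρ i j = PowerSeries.C (Nat.card G : ℂ)⁻¹ *
      ∑ g, PowerSeries.C ((σ i).character g * (σ j).character g⁻¹) * detOneSub (ρ g) := by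
  ext m
  simp_rw [detOneSub_eq_mk]
  rw [PowerSeries.coeff_C_mul, map_sum]
  simp_rw [PowerSeries.coeff_C_mul, PowerSeries.coeff_mk]
  rw [cgExtNeg, Matrix.of_apply, PowerSeries.coeff_mk, natCast_cgMatrix, mul_left_comm,
    Finset.mul_sum]
  congr 1
  exact Finset.sum_congr rfl fun g _ => by ring

variable {σ}

/-- The row `i` of `M[R_S(q)]` records the decomposition of `R_S(q) ⊗ R_i`, whose character is
`χ_i(g) / det (E - q R(g))`. -/
lemma IsIrrepList.sum_cgSym_mul_character (hσ : IsIrrepList σ) (ρ : Representation ℂ G V)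
    (i : Fin (n + 1)) (g : G) :
    ∑ k, cgSym σ ρ i k * PowerSeries.C ((σ k).character g) =
      (detOneSub (ρ g))⁻¹ * PowerSeries.C ((σ i).character g) := by
  ext m
  rw [inv_detOneSub, map_sum]
  simp_rw [PowerSeries.coeff_mul_C, PowerSeries.coeff_mk, cgSym, Matrix.of_apply,
    PowerSeries.coeff_mk, cgMatrix, Matrix.of_apply]
  rw [hσ.sum_multiplicity_mul_character, Representation.char_tensor, Pi.mul_apply]

/-- The Koszul identity `M[R_S(q)] M[R_A(-q)] = 1`. -/
lemma IsIrrepList.cgSym_mul_cgExtNeg (hσ : IsIrrepList σ) (ρ : Representation ℂ G V) :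
    cgSym σ ρ * cgExtNeg σ ρ = 1 := by
  ext1 i j
  rw [Matrix.mul_apply]
  simp_rw [cgExtNeg_apply, mul_left_comm (cgSym _ _ _ _), ← Finset.mul_sum, Finset.mul_sum]
  rw [Finset.sum_comm]
  have h : ∀ g : G, ∑ k, cgSym σ ρ i k *
      (PowerSeries.C ((σ k).character g * (σ j).character g⁻¹) * detOneSub (ρ g)) =
      PowerSeries.C ((σ i).character g * (σ j).character g⁻¹) := fun g => by
    have h1 := hσ.sum_cgSym_mul_character ρ i g
    have h2 := PowerSeries.inv_mul_cancel _ (constantCoeff_detOneSub_ne_zero ρ g)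
    simp_rw [map_mul, mul_assoc, ← mul_assoc (cgSym _ _ _ _), ← Finset.sum_mul, h1]
    linear_combination (PowerSeries.C ((σ i).character g) *
      PowerSeries.C ((σ j).character g⁻¹)) * h2
  simp_rw [← Finset.mul_sum, h]
  rw [← map_sum, ← map_mul, hσ.inner_character, Matrix.one_apply]
  split_ifs <;> simp

/-- `M[R_S(q)]` is determined by its row of index `0`, through the products with the `R_i`. -/
lemma IsIrrepList.cgSym_eq_sum_zero (hσ : IsIrrepList σ) (ρ : Representation ℂ G V)
    (i j : Fin (n + 1)) :
    cgSym σ ρ i j = ∑ k, (cgMatrix σ (σ i) k j : ℂ⟦X⟧) * cgSym σ ρ 0 k := by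
  have hM : ∀ k, (cgMatrix σ (σ i) k j : ℂ⟦X⟧) = PowerSeries.C (Nat.card G : ℂ)⁻¹ *
      ∑ g, PowerSeries.C ((σ k).character g) *
        PowerSeries.C ((σ j).character g⁻¹ * (σ i).character g) := fun k => by
    rw [← map_natCast (PowerSeries.C (R := ℂ)), natCast_cgMatrix, map_mul, map_sum]
    simp_rw [← map_mul, mul_assoc]
  simp_rw [hM, mul_assoc, ← Finset.mul_sum, Finset.sum_mul]
  rw [Finset.sum_comm, cgSym_apply]
  congr 1
  refine Finset.sum_congr rfl fun g _ => ?_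
  have h1 := hσ.sum_cgSym_mul_character ρ 0 g
  rw [hσ.character_zero, map_one, mul_one] at h1
  rw [← h1, Finset.mul_sum]
  refine Finset.sum_congr rfl fun k _ => ?_
  simp only [map_mul]
  ring

lemma IsIrrepList.isUnit_cgSym_zero_zero (hσ : IsIrrepList σ) (ρ : Representation ℂ G V) :
    IsUnit (cgSym σ ρ 0 0) := by
  rw [PowerSeries.isUnit_iff_constantCoeff, cgSym_apply]
  simp [hσ.character_zero, constantCoeff_detOneSub]

/-- A sum of a class function over the group, written over representatives of the classes. -/
lemma sum_eq_sum_classCard_mul {c : ℕ} {g : Fin c → G}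
    (hg : Function.Bijective fun p => ConjClasses.mk (g p)) (F : G → ℂ⟦X⟧)
    (hF : ∀ x y, F (y * x * y⁻¹) = F x) :
    ∑ x, F x = ∑ p, PowerSeries.C (classCard (g p)) * F (g p) := by
  classical
  rw [← Finset.sum_fiberwise _ (ConjClasses.mk (α := G)),
    ← (Equiv.ofBijective _ hg).sum_comp]
  refine Finset.sum_congr rfl fun p _ => ?_
  rw [Finset.sum_congr rfl (g := fun _ => F (g p)), Finset.sum_const, nsmul_eq_mul, classCard,
    map_natCast]
  · congr 2
    rw [Nat.card_eq_fintype_card, Fintype.card_subtype]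
    congr 1
    ext x
    simp [ConjClasses.mem_carrier_iff_mk_eq]
  · intro x hx
    obtain ⟨y, hy⟩ := isConj_iff.mp
      (ConjClasses.mk_eq_mk_iff_isConj.mp (Finset.mem_filter.mp hx).2)
    rw [← hF x y, hy]

/-- Molien's formula for the entries of `M[R_S(q)]`. -/
lemma cgSym_eq_sum_classes {c : ℕ} {g : Fin c → G}
    (hg : Function.Bijective fun p => ConjClasses.mk (g p)) (ρ : Representation ℂ G V)
    (i j : Fin (n + 1)) :
    cgSym σ ρ i j = PowerSeries.C (Nat.card G : ℂ)⁻¹ *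
      ∑ p, PowerSeries.C (classCard (g p)) * (detOneSub (ρ (g p)))⁻¹ *
        (PowerSeries.C ((σ i).character (g p)) *
          PowerSeries.C ((starRingEnd ℂ) ((σ j).character (g p)))) := by
  rw [cgSym_apply, sum_eq_sum_classCard_mul hg]
  · congr 1
    refine Finset.sum_congr rfl fun p _ => ?_
    rw [character_inv, map_mul]
    ring
  · intro x y
    simp_rw [inv_detOneSub, character_inv, Representation.char_conj]

end ClassSums

/-! ### Determinantal identities -/

section Determinants

/-- If `A B = 1` and `A₀₀` is invertible, the Schur complement of `A₀₀` in `A` is inverse to `B`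
without its row and column of index `0`. -/
lemma schurComplement_mul_submatrix {K : Type*} [CommRing K] {n : ℕ}
    {A B : Matrix (Fin (n + 1)) (Fin (n + 1)) K} (hAB : A * B = 1) {u : K} (hu : u * A 0 0 = 1) :
    (Matrix.of fun i j : Fin n =>
        u * (!![A 0 0, A 0 j.succ; A i.succ 0, A i.succ j.succ]).det) *
      B.submatrix Fin.succ Fin.succ = 1 := by
  ext i j
  have h0 := congrFun (congrFun hAB 0) j.succ
  have hi := congrFun (congrFun hAB i.succ) j.succ
  rw [Matrix.mul_apply, Fin.sum_univ_succ] at h0 hi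
  rw [Matrix.one_apply_ne (Fin.succ_ne_zero j).symm] at h0
  have hone : (1 : Matrix (Fin (n + 1)) (Fin (n + 1)) K) i.succ j.succ =
      (1 : Matrix (Fin n) (Fin n) K) i j := by
    simp [Matrix.one_apply]
  rw [Matrix.mul_apply, ← hone, ← hi]
  simp only [Matrix.of_apply, Matrix.det_fin_two_of, Matrix.submatrix_apply]
  have hs : ∀ k : Fin n, u * (A 0 0 * A i.succ k.succ - A 0 k.succ * A i.succ 0) *
      B k.succ j.succ = A i.succ k.succ * B k.succ j.succ -
        u * A i.succ 0 * (A 0 k.succ * B k.succ j.succ) := fun k => by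
    linear_combination (A i.succ k.succ * B k.succ j.succ) * hu
  simp_rw [hs, Finset.sum_sub_distrib, ← Finset.mul_sum]
  linear_combination (-u * A i.succ 0) * h0 + (A i.succ 0 * B 0 j.succ) * hu

/-- The Binet–Cauchy identity for a `2 × 2` determinant of weighted sums. -/
lemma weighted_sum_mul_sub {K ι : Type*} [CommRing K] [Fintype ι] [LinearOrder ι]
    [LocallyFiniteOrderTop ι] [LocallyFiniteOrderBot ι] (w a b : ι → K) :
    (∑ p, w p) * (∑ p, w p * (a p * b p)) - (∑ p, w p * b p) * (∑ p, w p * a p) =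
      ∑ p, ∑ r ∈ Finset.Ioi p, w p * w r * ((a p - a r) * (b p - b r)) := by
  let f : ι → ι → K := fun p r => w p * w r * (a p * b p - b r * a p)
  have h : ∀ p r, w p * w r * ((a p - a r) * (b p - b r)) = f r p + f p r := fun p r => by
    simp only [f]; ring
  simp_rw [h]
  rw [Finset.sum_sum_Ioi_add_eq_sum_sum_off_diag, Finset.sum_mul_sum, Finset.sum_mul_sum,
    ← Finset.sum_sub_distrib]
  refine Finset.sum_congr rfl fun p _ => ?_
  rw [← Finset.sum_sub_distrib, ← Finset.sum_compl_add_sum {p}]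
  simp only [Finset.sum_singleton]
  have hp : w p * (w p * (a p * b p)) - w p * b p * (w p * a p) = 0 := by ring
  rw [hp, add_zero]
  exact Finset.sum_congr rfl fun r _ => by simp only [f]; ring

end Determinants

/-! ### The Hilbert series of the covariants -/

section CovariantSeries

variable {G V : Type*} [Group G] [AddCommGroup V] [Module ℂ V] {ρ : Representation ℂ G V}

/-- The covariants of degree `m`: the intertwining maps from `τ` to `S(V)` with values in
`Sᵐ(V)`. -/
def covariantsOfDegree {A : Type*} [AddCommGroup A] [Module ℂ A] (τ : Representation ℂ G A)
    (ρ : Representation ℂ G V) (m : ℕ) :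
    Submodule ℂ (Representation.IntertwiningMap τ (symAlgRep ρ)) where
  carrier := {φ | ∀ a, φ a ∈ symPow V m}
  add_mem' h h' a := Submodule.add_mem _ (h a) (h' a)
  zero_mem' _ := Submodule.zero_mem _
  smul_mem' c _ h a := Submodule.smul_mem _ c (h a)

lemma iSupIndep_covariantsOfDegree {A : Type*} [AddCommGroup A] [Module ℂ A]
    (τ : Representation ℂ G A) : iSupIndep (covariantsOfDegree τ ρ) := by
  intro m
  rw [Submodule.disjoint_def]
  intro φ hφ hφ'
  ext a
  let ev : Representation.IntertwiningMap τ (symAlgRep ρ) →ₗ[ℂ] SymmetricAlgebra ℂ V :=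
    { toFun := fun φ => φ a
      map_add' := fun _ _ => rfl
      map_smul' := fun _ _ => rfl }
  refine Submodule.disjoint_def.mp (iSupIndep_symPow V m) (φ a) (hφ a) ?_
  have hle : ⨆ j, ⨆ _ : j ≠ m, covariantsOfDegree τ ρ j ≤
      (⨆ j, ⨆ _ : j ≠ m, symPow V j).comap ev :=
    iSup₂_le fun j hj ψ hψ => Submodule.mem_iSup_of_mem j (Submodule.mem_iSup_of_mem hj (hψ a))
  exact hle hφ'

/-- Covariants of degree `m` are the same thing as intertwining maps into `Sᵐ(V)`. -/
def covariantsOfDegreeEquiv {A : Type*} [AddCommGroup A] [Module ℂ A]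
    (τ : Representation ℂ G A) (ρ : Representation ℂ G V) (m : ℕ) :
    Representation.IntertwiningMap τ (symRep ρ m) ≃ₗ[ℂ] covariantsOfDegree τ ρ m where
  toFun φ := ⟨⟨(symPow V m).subtype ∘ₗ φ.toLinearMap, fun g => LinearMap.ext fun a =>
    congrArg Subtype.val (φ.isIntertwining _ _ g a)⟩, fun a => (φ a).2⟩
  invFun φ := ⟨φ.1.toLinearMap.codRestrict (symPow V m) φ.2, fun g => LinearMap.ext fun a =>
    Subtype.ext (φ.1.isIntertwining _ _ g a)⟩
  map_add' _ _ := rfl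
  map_smul' _ _ := rfl
  left_inv _ := rfl
  right_inv _ := rfl

variable {n : ℕ} {W : Fin (n + 1) → Type*} [∀ i, AddCommGroup (W i)] [∀ i, Module ℂ (W i)]
  {σ : ∀ i, Representation ℂ G (W i)}

namespace CMDecomposition

lemma symMap_aeval (D : CMDecomposition ρ σ) (p : MvPolynomial (Fin (finrank ℂ V)) ℂ) (g : G) :
    symMap (ρ g) (MvPolynomial.aeval (fun l => (D.θ l : SymmetricAlgebra ℂ V)) p) =
      MvPolynomial.aeval (fun l => (D.θ l : SymmetricAlgebra ℂ V)) p := by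
  rw [← AlgHom.comp_apply, MvPolynomial.comp_aeval]
  congr 2
  ext1 l
  exact (D.θ l).2 g

/-- The covariant `∑ₖ pₖ(θ) ρ_{kj}` with coefficients `pₖ`, as a linear function of the
coefficients. -/
noncomputable def ofCoeff (D : CMDecomposition ρ σ) (j : Fin (n + 1)) :
    (Fin (D.μ j) → MvPolynomial (Fin (finrank ℂ V)) ℂ) →ₗ[ℂ]
      Representation.IntertwiningMap (σ j) (symAlgRep ρ) where
  toFun p :=
    { toLinearMap := ∑ k, LinearMap.mulLeft ℂ
        (MvPolynomial.aeval (fun l => (D.θ l : SymmetricAlgebra ℂ V)) (p k)) ∘ₗ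
          (D.gen j k).toLinearMap
      isIntertwining' := fun g => by
        ext a
        simp only [LinearMap.comp_apply, LinearMap.sum_apply, LinearMap.mulLeft_apply, map_sum]
        refine Finset.sum_congr rfl fun k _ => ?_
        change _ * D.gen j k (σ j g a) = symMap (ρ g) (_ * D.gen j k a)
        rw [map_mul, D.symMap_aeval, (D.gen j k).isIntertwining]
        rfl }
  map_add' p q := by
    ext a
    simp [add_mul, Finset.sum_add_distrib]
  map_smul' c p := by
    ext a
    simp [Finset.smul_sum]

lemma ofCoeff_apply (D : CMDecomposition ρ σ) (j : Fin (n + 1))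
    (p : Fin (D.μ j) → MvPolynomial (Fin (finrank ℂ V)) ℂ) (a : W j) :
    D.ofCoeff j p a = ∑ k, MvPolynomial.aeval
      (fun l => (D.θ l : SymmetricAlgebra ℂ V)) (p k) * D.gen j k a := by
  change (∑ k, LinearMap.mulLeft ℂ _ ∘ₗ _ : W j →ₗ[ℂ] SymmetricAlgebra ℂ V) a = _
  simp

lemma bijective_ofCoeff (D : CMDecomposition ρ σ) (j : Fin (n + 1)) :
    Function.Bijective (D.ofCoeff j) := by
  refine (Function.bijective_iff_existsUnique _).mpr fun φ => ?_
  refine (existsUnique_congr fun p => ?_).mp (D.decomposition j φ)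
  rw [eq_comm (b := φ), Representation.IntertwiningMap.ext_iff, LinearMap.ext_iff]
  exact forall_congr' fun a => by
    rw [← D.ofCoeff_apply]
    rfl

/-- The basis of the covariants over `ℂ` consisting of the products of the monomials in
`θ_1, …, θ_d` with the generators. -/
noncomputable def monomialBasis (D : CMDecomposition ρ σ) (j : Fin (n + 1)) :
    Basis ((_ : Fin (D.μ j)) × (Fin (finrank ℂ V) →₀ ℕ)) ℂ
      (Representation.IntertwiningMap (σ j) (symAlgRep ρ)) :=
  (Pi.basis fun _ => MvPolynomial.basisMonomials _ ℂ).map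
    (LinearEquiv.ofBijective _ (D.bijective_ofCoeff j))

lemma monomialBasis_mem (D : CMDecomposition ρ σ) (j : Fin (n + 1))
    (x : (_ : Fin (D.μ j)) × (Fin (finrank ℂ V) →₀ ℕ)) :
    D.monomialBasis j x ∈
      covariantsOfDegree (σ j) ρ (Finsupp.weight D.deg x.2 + D.m j x.1) := by
  classical
  obtain ⟨k, e⟩ := x
  intro a
  rw [monomialBasis, Basis.map_apply, LinearEquiv.ofBijective_apply, ofCoeff_apply,
    Finset.sum_eq_single k]
  · have : SetLike.GradedMonoid (symPow V) :=
      Submodule.nat_power_gradedMonoid (LinearMap.range (SymmetricAlgebra.ι ℂ V))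
    refine SetLike.mul_mem_graded ?_ (D.homogeneous j k a)
    have h := SetLike.prod_pow_mem_graded (symPow V) D.deg
      (fun l => (D.θ l : SymmetricAlgebra ℂ V)) (F := Finset.univ) e
      fun l _ => D.isHSOP.homogeneous l
    rw [Finsupp.weight_apply, Finsupp.sum_fintype _ _ (by simp)]
    simpa [Pi.basis_apply, MvPolynomial.aeval_monomial, Finsupp.prod_fintype] using h
  · intro k' _ hk'
    simp [Pi.basis_apply, hk']
  · simp

lemma multiplicity_symRep (D : CMDecomposition ρ σ) (j : Fin (n + 1)) (N : ℕ) :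
    multiplicity (σ j) (symRep ρ N) =
      ∑ k, Nat.card {e : Fin (finrank ℂ V) →₀ ℕ // Finsupp.weight D.deg e + D.m j k = N} := by
  have hfin : ∀ k, Finite {e : Fin (finrank ℂ V) →₀ ℕ //
      Finsupp.weight D.deg e + D.m j k = N} := fun k =>
    ((Finsupp.finite_of_nat_weight_le D.deg (fun l => (D.isHSOP.deg_pos l).ne') N).subset
      fun e he => le_of_add_le_left (le_of_eq he) : {e : Fin (finrank ℂ V) →₀ ℕ |
        Finsupp.weight D.deg e + D.m j k = N}.Finite)
  rw [multiplicity, (covariantsOfDegreeEquiv (σ j) ρ N).finrank_eq,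
    finrank_eq_nat_card_basis (componentBasis (D.monomialBasis j)
      (iSupIndep_covariantsOfDegree (σ j)) (D.monomialBasis_mem j) N), ← Nat.card_sigma]
  exact Nat.card_congr
    { toFun := fun x => ⟨x.1.1, x.1.2, x.2⟩
      invFun := fun x => ⟨⟨x.1, x.2.1⟩, x.2.2⟩
      left_inv := fun _ => rfl
      right_inv := fun _ => rfl }

/-- The Hilbert series of the covariants, read off from their freeness over
`ℂ[θ_1, …, θ_d]`. -/
lemma mk_multiplicity_mul (D : CMDecomposition ρ σ) (j : Fin (n + 1)) :
    (PowerSeries.mk fun N => (multiplicity (σ j) (symRep ρ N) : ℂ)) *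
      (((1 - Polynomial.X) ^ finrank ℂ V * D.DR : Polynomial ℂ) : ℂ⟦X⟧) =
      (D.Dzero j : ℂ⟦X⟧) := by
  have hfin := finite_weight_eq D.isHSOP.deg_pos
  let _ := fun m => @Fintype.ofFinite _ (hfin m)
  have hw := mk_sum_weight_mul_prod D.isHSOP.deg_pos fun _ => 1
  simp only [map_one, one_mul, one_pow, Finset.prod_const_one, Finset.sum_const, nsmul_eq_mul,
    mul_one, Finset.card_univ, ← Nat.card_eq_fintype_card] at hw
  have hP : (((1 - Polynomial.X) ^ finrank ℂ V * D.DR : Polynomial ℂ) : ℂ⟦X⟧) =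
      ∏ k, (1 - PowerSeries.X ^ D.deg k) := by
    rw [D.one_sub_pow_mul_DR, ← Polynomial.coeToPowerSeries.ringHom_apply, map_prod]
    simp
  have hZ : (D.Dzero j : ℂ⟦X⟧) = ∑ k, PowerSeries.X ^ D.m j k := by
    rw [Dzero, ← Polynomial.coeToPowerSeries.ringHom_apply, map_sum]
    simp
  have hS : (PowerSeries.mk fun N => (multiplicity (σ j) (symRep ρ N) : ℂ)) =
      (∑ k, PowerSeries.X ^ D.m j k) * PowerSeries.mk fun N =>
        (Nat.card {e : Fin (finrank ℂ V) →₀ ℕ // Finsupp.weight D.deg e = N} : ℂ) := by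
    ext N
    rw [Finset.sum_mul, map_sum, PowerSeries.coeff_mk, D.multiplicity_symRep, Nat.cast_sum]
    refine Finset.sum_congr rfl fun k _ => ?_
    rw [PowerSeries.coeff_X_pow_mul', PowerSeries.coeff_mk]
    split_ifs with h
    · congr 1
      exact Nat.card_congr (Equiv.subtypeEquivRight fun e => by lia)
    · have : IsEmpty {e : Fin (finrank ℂ V) →₀ ℕ // Finsupp.weight D.deg e + D.m j k = N} :=
        ⟨fun e => h (by have := e.2; lia)⟩
      simp
  rw [hP, hS, mul_assoc, hw, mul_one, hZ]

lemma isUnit_mul_DR (D : CMDecomposition ρ σ) :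
    IsUnit (((1 - Polynomial.X) ^ finrank ℂ V * D.DR : Polynomial ℂ) : ℂ⟦X⟧) := by
  rw [D.one_sub_pow_mul_DR, PowerSeries.isUnit_iff_constantCoeff,
    ← Polynomial.coeToPowerSeries.ringHom_apply, map_prod, map_prod]
  simp [(D.isHSOP.deg_pos _).ne']

variable [Finite G] [FiniteDimensional ℂ V] [∀ i, FiniteDimensional ℂ (W i)]

lemma cgSym_zero_mul (D : CMDecomposition ρ σ) (hσ : IsIrrepList σ) (j : Fin (n + 1)) :
    cgSym σ ρ 0 j * (((1 - Polynomial.X) ^ finrank ℂ V * D.DR : Polynomial ℂ) : ℂ⟦X⟧) =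
      (D.Dzero j : ℂ⟦X⟧) := by
  have := Fintype.ofFinite G
  rw [← D.mk_multiplicity_mul]
  congr 1
  ext N
  rw [cgSym, Matrix.of_apply, PowerSeries.coeff_mk, PowerSeries.coeff_mk, natCast_cgMatrix,
    natCast_multiplicity]
  simp only [hσ.character_zero, one_mul]
  simp only [mul_comm]

/-- The entries of `M[R_S(q)]` are `D[R]_j^i / ((1 - q)^d D(R))`. -/
lemma cgSym_mul (D : CMDecomposition ρ σ) (hσ : IsIrrepList σ) (i j : Fin (n + 1)) :
    cgSym σ ρ i j * (((1 - Polynomial.X) ^ finrank ℂ V * D.DR : Polynomial ℂ) : ℂ⟦X⟧) =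
      (D.Dmat i j : ℂ⟦X⟧) := by
  have := Fintype.ofFinite G
  have hM : (D.Dmat i j : ℂ⟦X⟧) =
      ∑ k, (cgMatrix σ (σ i) k j : ℂ⟦X⟧) * (D.Dzero k : ℂ⟦X⟧) := by
    rw [Dmat, ← Polynomial.coeToPowerSeries.ringHom_apply, map_sum]
    simp_rw [map_mul, map_natCast, Polynomial.coeToPowerSeries.ringHom_apply]
  rw [hσ.cgSym_eq_sum_zero, Finset.sum_mul, hM]
  refine Finset.sum_congr rfl fun k _ => ?_
  rw [mul_assoc, D.cgSym_zero_mul hσ]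

end CMDecomposition

end CovariantSeries

end ClebschGordan

theorem mainTheorem5
    {G : Type*} [Group G] [Finite G]
    -- the representation `R`
    {V : Type*} [AddCommGroup V] [Module ℂ V] [FiniteDimensional ℂ V]
    (ρ : Representation ℂ G V)
    -- the irreducible representations `R_0 = 1, R_1, …, R_n`
    {n : ℕ} {W : Fin (n + 1) → Type*} [∀ i, AddCommGroup (W i)] [∀ i, Module ℂ (W i)]
    [∀ i, FiniteDimensional ℂ (W i)]
    (σ : ∀ i, Representation ℂ G (W i)) (hσ : IsIrrepList σ)
    -- representatives of the conjugacy classes, listed without repetitions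
    {c : ℕ} (g : Fin c → G) (hg : Function.Bijective fun p => ConjClasses.mk (g p)) :
    -- everything that is inverted below is invertible
    IsUnit (euclideanCG σ ρ) ∧ IsUnit (cgSym σ ρ 0 0) ∧ (∀ p, IsUnit (detOneSub (ρ (g p)))) ∧
    IsUnit (∑ p, PowerSeries.C (classCard (g p)) * (detOneSub (ρ (g p)))⁻¹) ∧
    (∀ D : CMDecomposition ρ σ, IsUnit
      (((1 - Polynomial.X) ^ Module.finrank ℂ V * D.DR * D.Dmat 0 0 : Polynomial ℂ) : ℂ⟦X⟧)) ∧
    ∀ i j : Fin n,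
      (euclideanCG σ ρ)⁻¹ i j =
        (cgSym σ ρ 0 0)⁻¹ *
          (!![cgSym σ ρ 0 0, cgSym σ ρ 0 j.succ;
              cgSym σ ρ i.succ 0, cgSym σ ρ i.succ j.succ]).det ∧
      (euclideanCG σ ρ)⁻¹ i j =
        PowerSeries.C (1 / (Nat.card G : ℂ)) *
          (∑ p, ∑ r ∈ Finset.Ioi p,
            PowerSeries.C (classCard (g p) * classCard (g r) *
              ((σ i.succ).character (g p) - (σ i.succ).character (g r)) *
              (starRingEnd ℂ) ((σ j.succ).character (g p) - (σ j.succ).character (g r))) *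
            (detOneSub (ρ (g p)) * detOneSub (ρ (g r)))⁻¹) *
          (∑ p, PowerSeries.C (classCard (g p)) * (detOneSub (ρ (g p)))⁻¹)⁻¹ ∧
      ∀ D : CMDecomposition ρ σ,
        (euclideanCG σ ρ)⁻¹ i j =
          (((1 - Polynomial.X) ^ Module.finrank ℂ V * D.DR * D.Dmat 0 0 : Polynomial ℂ) : ℂ⟦X⟧)⁻¹ *
            ((!![D.Dmat 0 0, D.Dmat 0 j.succ;
                D.Dmat i.succ 0, D.Dmat i.succ j.succ]).det : Polynomial ℂ) := by
  have := Fintype.ofFinite G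
  let S : Matrix (Fin n) (Fin n) ℂ⟦X⟧ := Matrix.of fun i j =>
    (cgSym σ ρ 0 0)⁻¹ * (!![cgSym σ ρ 0 0, cgSym σ ρ 0 j.succ;
      cgSym σ ρ i.succ 0, cgSym σ ρ i.succ j.succ]).det
  have hu := hσ.isUnit_cgSym_zero_zero ρ
  have hu₀ := (PowerSeries.isUnit_iff_constantCoeff.mp hu).ne_zero
  have hS : S * euclideanCG σ ρ = 1 := schurComplement_mul_submatrix
    (hσ.cgSym_mul_cgExtNeg ρ) (PowerSeries.inv_mul_cancel _ hu₀)
  have hinv : ∀ i j, (euclideanCG σ ρ)⁻¹ i j = S i j := fun i j => by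
    rw [Matrix.inv_eq_left_inv hS]
  have hcard : (Nat.card G : ℂ) ≠ 0 := by exact_mod_cast Nat.card_pos.ne'
  have hA := cgSym_eq_sum_classes (σ := σ) hg ρ
  have hone : ∀ p, (σ 0).character (g p) = 1 := fun p => hσ.character_zero (g p)
  have hC : PowerSeries.C (Nat.card G : ℂ) * PowerSeries.C (Nat.card G : ℂ)⁻¹ = 1 := by
    rw [← map_mul, mul_inv_cancel₀ hcard, map_one]
  -- the class sum in the denominator is `|G|` times the Hilbert series of the invariants
  have hden : ∑ p, PowerSeries.C (classCard (g p)) * (detOneSub (ρ (g p)))⁻¹ =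
      PowerSeries.C (Nat.card G : ℂ) * cgSym σ ρ 0 0 := by
    rw [hA, ← mul_assoc, hC, one_mul]
    simp [hone]
  have hcu : IsUnit (PowerSeries.C (Nat.card G : ℂ)) := (IsUnit.mk0 _ hcard).map _
  have hdenu := hcu.mul hu
  have hD : ∀ D : CMDecomposition ρ σ,
      (((1 - Polynomial.X) ^ Module.finrank ℂ V * D.DR * D.Dmat 0 0 : Polynomial ℂ) : ℂ⟦X⟧) =
        (((1 - Polynomial.X) ^ Module.finrank ℂ V * D.DR : Polynomial ℂ) : ℂ⟦X⟧) *
          (cgSym σ ρ 0 0 *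
            (((1 - Polynomial.X) ^ Module.finrank ℂ V * D.DR : Polynomial ℂ) : ℂ⟦X⟧)) :=
    fun D => by rw [D.cgSym_mul hσ, Polynomial.coe_mul]
  have hDu : ∀ D : CMDecomposition ρ σ, IsUnit
      (((1 - Polynomial.X) ^ Module.finrank ℂ V * D.DR * D.Dmat 0 0 : Polynomial ℂ) : ℂ⟦X⟧) :=
    fun D => by
      rw [hD]
      exact D.isUnit_mul_DR.mul (hu.mul D.isUnit_mul_DR)
  refine ⟨IsUnit.of_mul_eq_one_right S hS, hu, fun p => ?_, ?_, hDu, fun i j =>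
    ⟨hinv i j, ?_, fun D => ?_⟩⟩
  · rw [PowerSeries.isUnit_iff_constantCoeff, constantCoeff_detOneSub]
    exact isUnit_one
  · rw [hden]
    exact hdenu
  · rw [hinv, hden]
    have hBC : (!![cgSym σ ρ 0 0, cgSym σ ρ 0 j.succ;
        cgSym σ ρ i.succ 0, cgSym σ ρ i.succ j.succ]).det =
        PowerSeries.C (Nat.card G : ℂ)⁻¹ ^ 2 * ∑ p, ∑ r ∈ Finset.Ioi p,
          PowerSeries.C (classCard (g p) * classCard (g r) *
            ((σ i.succ).character (g p) - (σ i.succ).character (g r)) *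
            (starRingEnd ℂ) ((σ j.succ).character (g p) - (σ j.succ).character (g r))) *
          (detOneSub (ρ (g p)) * detOneSub (ρ (g r)))⁻¹ := by
      have h := weighted_sum_mul_sub
        (fun p => PowerSeries.C (classCard (g p)) * (detOneSub (ρ (g p)))⁻¹)
        (fun p => PowerSeries.C ((σ i.succ).character (g p)))
        (fun p => PowerSeries.C ((starRingEnd ℂ) ((σ j.succ).character (g p))))
      rw [Matrix.det_fin_two_of, hA 0 0, hA 0 j.succ, hA i.succ 0, hA i.succ j.succ]
      simp only [hone, map_one, one_mul, mul_one]
      rw [Finset.sum_congr rfl fun p _ => Finset.sum_congr rfl fun r _ => ?_, ← h]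
      · ring
      · rw [PowerSeries.mul_inv_rev]
        simp only [map_mul, map_sub]
        ring
    simp only [S, Matrix.of_apply]
    rw [hBC, PowerSeries.mul_inv_rev, PowerSeries.C_inv, one_div]
    ring
  · rw [hinv]
    simp only [S, Matrix.of_apply]
    have h1 := PowerSeries.inv_mul_cancel _ hu₀
    have h2 := PowerSeries.mul_inv_cancel _
      (PowerSeries.isUnit_iff_constantCoeff.mp (hDu D)).ne_zero
    have h3 : ((!![D.Dmat 0 0, D.Dmat 0 j.succ;
        D.Dmat i.succ 0, D.Dmat i.succ j.succ]).det : Polynomial ℂ) =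
        (((1 - Polynomial.X) ^ Module.finrank ℂ V * D.DR : Polynomial ℂ) : ℂ⟦X⟧) ^ 2 *
        (!![cgSym σ ρ 0 0, cgSym σ ρ 0 j.succ;
          cgSym σ ρ i.succ 0, cgSym σ ρ i.succ j.succ]).det := by
      rw [Matrix.det_fin_two_of, Matrix.det_fin_two_of, Polynomial.coe_sub, Polynomial.coe_mul,
        Polynomial.coe_mul]
      simp only [← D.cgSym_mul hσ]
      ring
    rw [h3]
    set E := (((1 - Polynomial.X) ^ Module.finrank ℂ V * D.DR * D.Dmat 0 0 : Polynomial ℂ) : ℂ⟦X⟧)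
    set P := (((1 - Polynomial.X) ^ Module.finrank ℂ V * D.DR : Polynomial ℂ) : ℂ⟦X⟧)
    set M := (!![cgSym σ ρ 0 0, cgSym σ ρ 0 j.succ;
          cgSym σ ρ i.succ 0, cgSym σ ρ i.succ j.succ]).det
    -- with `P = (1 - q)^d D(R)`, each row of the `2 × 2` matrix acquires a factor `P`, and the
    -- denominator `E` is `P² A₀₀`
    have hE : E = P * (cgSym σ ρ 0 0 * P) := hD D
    have key : (cgSym σ ρ 0 0)⁻¹ = E⁻¹ * P ^ 2 := by
      linear_combination (-(cgSym σ ρ 0 0)⁻¹) * h2 + (cgSym σ ρ 0 0)⁻¹ * E⁻¹ * hE +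
        (P ^ 2 * E⁻¹) * h1
    rw [key]
    ring
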